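/- Let $N\ge 2$ and let $K\subset\mathbb R^N$ be a compact set such that * (K1) $\mathbb R^N\setminus K$ is connected and $K$ contains an open ball $B_{r_0}$ centred at the origin, for some $r_0>0$; * (K2) at every point $x\in\partial K$ the boundary has an inner unit normal vector $\nu(x)$ (pointing into $K$), and $\nu(x)\cdot x\le 0$ for all $x\in\partial K$. Here $\nu(x)$ is the unit vector $\nu$ such that for every $\varepsilon>0$ all $y$ sufficiently close to $x$ satisfy: $y\in K$ if $\nu\cdot(y-x)>\varepsilon|y-x|$, and $y\notin K$ if $\nu\cdot(y-x)<-\varepsilon|y-x|$ (the usual inner unit normal if $\partial K$ is $C^1$). Let $p,q,m,s,\lambda>0$, let $\gamma\in(0,1)$, and let $\rho\in C^{0,\gamma}_{loc}(\overline{\mathbb R^N\setminus K})$ be nonnegative. Consider the Gierer–Meinhardt system $$ \begin{cases} -\Delta u=\dfrac{u^p}{v^q}+\lambda\rho(x),\quad u>0 &\text{in }\mathbb R^N\setminus K,\\[2mm] -\Delta v=\dfrac{u^m}{v^s},\quad v>0 &\text{in }\mathbb R^N\setminus K,\\[2mm] \dfrac{\partial u}{\partial\nu}=\dfrac{\partial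 v}{\partial\nu}=0 &\text{on }\partial K,\\[2mm] u(x),v(x)\to 0 &\text{as }|x|\to\infty. \end{cases} $$ A positive solution is a pair $u,v\in C^2(\overline{\mathbb R^N\setminus K})$ satisfying the system; here $C^2(\overline{\mathbb R^N\setminus K})$ denotes the continuous functions on $\overline{\mathbb R^N\setminus K}$ that are $C^2$ in $\mathbb R^N\setminus K$ and whose derivatives of order at most $2$ extend continuously to $\overline{\mathbb R^N\setminus K}$. **Theorem (Nonexistence).** The system has no positive solution in any of the following situations: 1. $N=2$; 2. $N\ge 3$ and $m\le \dfrac{2}{N-2}$; 3. $N\ge 3$ and $0<p\le \dfrac{N}{N-2}$. -/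

import Mathlib

open Set Filter Topology
open scoped NNReal

/-- `ν` is the inner unit normal to (the boundary of) `K` at the boundary point `x`: infinitesimally
at `x`, the set `K` is the half-space `{y | 0 ≤ ⟪ν, y - x⟫}`, i.e. every open cone around `ν` with
opening angle less than `π / 2` is locally contained in `K`, and every such cone around `-ν` is
locally contained in the complement of `K`. When `∂K` is `C¹` this is the usual inner unit normal;
at every point there is at most one such vector. -/
structure IsInnerUnitNormal {E : Type*} [NormedAddCommGroup E] [InnerProductSpace ℝ E]
    (K : Set E) (x ν : E) : Prop where
  norm_eq : ‖ν‖ = 1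
  inner_side : ∀ ε > (0 : ℝ), ∀ᶠ y in 𝓝 x, ε * ‖y - x‖ < inner ℝ ν (y - x) → y ∈ K
  outer_side : ∀ ε > (0 : ℝ), ∀ᶠ y in 𝓝 x, inner ℝ ν (y - x) < -(ε * ‖y - x‖) → y ∉ K

/-- The standing assumptions on the compact set `K ⊆ ℝᴺ`: its complement is connected, it contains
a ball centred at the origin, and its boundary has an inner unit normal `ν(x)` at each of its
points `x`, with `ν(x) · x ≤ 0`. -/
structure IsAdmissibleObstacle {N : ℕ} (K : Set (EuclideanSpace ℝ (Fin N))) : Prop where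
  isCompact : IsCompact K
  isConnected_compl : IsConnected Kᶜ
  exists_ball_subset : ∃ r₀ > (0 : ℝ), Metric.ball 0 r₀ ⊆ K
  exists_normal : ∀ x ∈ frontier K, ∃ ν, IsInnerUnitNormal K x ν
  normal_inner_nonpos : ∀ x ∈ frontier K, ∀ ν, IsInnerUnitNormal K x ν → inner ℝ ν x ≤ 0

/-- The class `C^n(closure Ω)` for an open set `Ω`: functions of class `C^n` in `Ω`, continuous on
`closure Ω`, all of whose derivatives of order at most `n` have continuous extensions to
`closure Ω`. -/
structure IsContDiffUpToBoundary {E : Type*} [NormedAddCommGroup E] [NormedSpace ℝ E]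
    (n : ℕ) (u : E → ℝ) (Ω : Set E) : Prop where
  contDiffOn : ContDiffOn ℝ n u Ω
  continuousOn : ContinuousOn u (closure Ω)
  exists_extension : ∀ k ≤ n, ∃ G : E → ContinuousMultilinearMap ℝ (fun _ : Fin k => E) ℝ,
    ContinuousOn G (closure Ω) ∧ EqOn (iteratedFDeriv ℝ k u) G Ω

/-- The class `C^{0,γ}_loc(S)`: functions that are `γ`-Hölder continuous on each compact subset
of `S`. -/
def IsLocallyHolderOn {E : Type*} [MetricSpace E] (γ : ℝ≥0) (ρ : E → ℝ) (S : Set E) : Prop :=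
  ∀ T ⊆ S, IsCompact T → ∃ C : ℝ≥0, HolderOnWith C γ ρ T

/-- The homogeneous Neumann condition `∂w/∂ν = 0` on `∂K` for a function `w` on the closure of the
complement of `K`: at each boundary point `x`, the one-sided derivative of `w` along the normal
segment `t ↦ x - t ν(x)`, `t ≥ 0` (which enters the complement of `K`), exists and vanishes. -/
def NeumannZero {E : Type*} [NormedAddCommGroup E] [InnerProductSpace ℝ E]
    (K : Set E) (w : E → ℝ) : Prop :=
  ∀ x ∈ frontier K, ∀ ν, IsInnerUnitNormal K x ν →
    HasDerivWithinAt (fun t : ℝ => w (x - t • ν)) 0 (Ici 0) 0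

/-- `(u, v)` is a positive classical solution of the steady-state Gierer–Meinhardt system
`-Δu = u^p / v^q + lam * ρ`, `-Δv = u^m / v^s` in `ℝᴺ ∖ K`, with homogeneous Neumann conditions on
`∂K` and decay to `0` at infinity. Only the values of `u`, `v` on the closure of `ℝᴺ ∖ K` matter. -/
structure IsPositiveGMSolution {N : ℕ} (K : Set (EuclideanSpace ℝ (Fin N))) (p q m s lam : ℝ)
    (ρ u v : EuclideanSpace ℝ (Fin N) → ℝ) : Prop where
  u_regular : IsContDiffUpToBoundary 2 u Kᶜ
  v_regular : IsContDiffUpToBoundary 2 v Kᶜ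
  u_pos : ∀ x ∈ Kᶜ, 0 < u x
  v_pos : ∀ x ∈ Kᶜ, 0 < v x
  u_eq : ∀ x ∈ Kᶜ, -(Laplacian.laplacian u x) = u x ^ p / v x ^ q + lam * ρ x
  v_eq : ∀ x ∈ Kᶜ, -(Laplacian.laplacian v x) = u x ^ m / v x ^ s
  u_neumann : NeumannZero K u
  v_neumann : NeumannZero K v
  u_decay : Tendsto u (Bornology.cobounded (EuclideanSpace ℝ (Fin N))) (𝓝 0)
  v_decay : Tendsto v (Bornology.cobounded (EuclideanSpace ℝ (Fin N))) (𝓝 0)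

/-! Everything happens outside a large ball containing `K` on which `u, v < 1`. There the
denominators only help: `-Δu ≥ u^p` and `-Δv ≥ u^m`. Put `a = (N - 2) / 2`, so that `|x|^(2 - N) =
(|x|²)^(-a)`.

For `N = 2`, a positive superharmonic function cannot decay, by comparison with a logarithm. For `N
≥ 3`, comparison with the fundamental solution gives `u ≥ M |x|^(2 - N)`. If `a m ≤ 1`, then `-Δv ≥
k |x|^(-2)`, which would make `v` unbounded. If `p ≤ 1 + 1/a`, then `u < 1` reduces to the critical
inequality `-Δu ≥ u^(1 + 1/a)`. Inserting the lower bound on the right gains a logarithm, so `M`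
doubles once `log |x|²` has grown by a multiple of `M^(-1/a)`. These increments form a convergent
geometric series, so `u` is infinite at a finite point.

All barriers belong to the family `radialProfile`, and all comparisons go through
`radialProfile_le`. -/

section Laplacian

variable {E : Type*} [NormedAddCommGroup E] [InnerProductSpace ℝ E]

/-! ### Second derivatives along lines and the minimum principle -/

theorem iteratedFDeriv_two_eq_deriv_deriv_line {f : E → ℝ} {x : E} (hf : ContDiffAt ℝ 2 f x)
    (e : E) :
    iteratedFDeriv ℝ 2 f x ![e, e] = deriv (deriv fun t : ℝ => f (x + t • e)) 0 := by
  have hl : ∀ t : ℝ, HasDerivAt (fun t : ℝ => x + t • e) e t := fun t => by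
    simpa using ((hasDerivAt_id t).smul_const e).const_add x
  have hc : Tendsto (fun t : ℝ => x + t • e) (𝓝 0) (𝓝 x) := by
    simpa using (hl 0).continuousAt.tendsto
  have h1 : deriv (fun t : ℝ => f (x + t • e)) =ᶠ[𝓝 0] fun t => fderiv ℝ f (x + t • e) e := by
    filter_upwards [hc.eventually (hf.eventually (by simp))] with t ht
    exact ((ht.differentiableAt (by simp)).hasFDerivAt.comp_hasDerivAt t (hl t)).deriv
  rw [h1.deriv_eq, iteratedFDeriv_two_apply]
  have h2 : HasFDerivAt (fderiv ℝ f) (fderiv ℝ (fderiv ℝ f) x) x :=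
    ((hf.fderiv_right (m := 1) (by norm_num)).differentiableAt (by simp)).hasFDerivAt
  have h3 : HasDerivAt (fun t : ℝ => fderiv ℝ f (x + t • e)) (fderiv ℝ (fderiv ℝ f) x e) 0 :=
    h2.comp_hasDerivAt_of_eq (0 : ℝ) (hl 0) (by simp)
  have h4 := h3.clm_apply (hasDerivAt_const (0 : ℝ) e)
  rw [h4.deriv]
  simp

/-- A negative second derivative would make the point a local maximum too, hence the function
locally constant, with second derivative zero. -/
theorem IsLocalMin.deriv_deriv_nonneg {g : ℝ → ℝ} {t : ℝ} (h : IsLocalMin g t)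
    (hc : ContinuousAt g t) : 0 ≤ deriv (deriv g) t := by
  by_contra! hlt
  have hmax := isLocalMax_of_deriv_deriv_neg hlt h.deriv_eq_zero hc
  have heq : g =ᶠ[𝓝 t] fun _ => g t := by
    filter_upwards [h, hmax] with y h₁ h₂
    exact le_antisymm h₂ h₁
  have := heq.deriv.deriv_eq
  simp [this] at hlt

variable [FiniteDimensional ℝ E]

theorem IsLocalMin.laplacian_nonneg {f : E → ℝ} {x : E} (h : IsLocalMin f x)
    (hf : ContDiffAt ℝ 2 f x) : 0 ≤ Laplacian.laplacian f x := by
  rw [InnerProductSpace.laplacian_eq_iteratedFDeriv_stdOrthonormalBasis]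
  refine Finset.sum_nonneg fun i _ => ?_
  rw [iteratedFDeriv_two_eq_deriv_deriv_line hf]
  set e := stdOrthonormalBasis ℝ E i
  have hl : ContinuousAt (fun t : ℝ => x + t • e) 0 := by fun_prop
  have hl0 : x + (0 : ℝ) • e = x := by simp
  refine IsLocalMin.deriv_deriv_nonneg ?_ ?_
  · have : Tendsto (fun t : ℝ => x + t • e) (𝓝 0) (𝓝 x) := by simpa [ContinuousAt] using hl
    filter_upwards [this.eventually h] with t ht
    simpa using ht
  · exact ContinuousAt.comp (f := fun t : ℝ => x + t • e) (by rw [hl0]; exact hf.continuousAt) hl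

/-- The Laplacian of a radial function, written in terms of the squared norm. -/
theorem laplacian_comp_norm_sq {φ φ' : ℝ → ℝ} {d : ℝ} {x : E}
    (hφ : ContDiffAt ℝ 2 φ (‖x‖ ^ 2))
    (h₁ : ∀ᶠ s in 𝓝 (‖x‖ ^ 2), HasDerivAt φ (φ' s) s) (h₂ : HasDerivAt φ' d (‖x‖ ^ 2)) :
    Laplacian.laplacian (fun y : E => φ (‖y‖ ^ 2)) x =
      4 * ‖x‖ ^ 2 * d + 2 * Module.finrank ℝ E * φ' (‖x‖ ^ 2) := by
  have hf : ContDiffAt ℝ 2 (fun y : E => φ (‖y‖ ^ 2)) x :=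
    ContDiffAt.comp (f := fun y : E => ‖y‖ ^ 2) x hφ (contDiff_norm_sq ℝ).contDiffAt
  set b := stdOrthonormalBasis ℝ E
  have key : ∀ i, iteratedFDeriv ℝ 2 (fun y : E => φ (‖y‖ ^ 2)) x ![b i, b i] =
      4 * d * (inner ℝ x (b i)) ^ 2 + 2 * φ' (‖x‖ ^ 2) := by
    intro i
    rw [iteratedFDeriv_two_eq_deriv_deriv_line hf]
    set c := inner ℝ x (b i) with hc
    have hsq : ∀ t : ℝ, ‖x + t • b i‖ ^ 2 = ‖x‖ ^ 2 + 2 * c * t + t ^ 2 := fun t => by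
      rw [norm_add_sq_real, inner_smul_right, norm_smul, b.norm_eq_one i, Real.norm_eq_abs,
        mul_one, sq_abs]
      ring
    simp_rw [hsq]
    have hl : ∀ t : ℝ, HasDerivAt (fun t : ℝ => ‖x‖ ^ 2 + 2 * c * t + t ^ 2)
        (2 * c + 2 * t) t := fun t => by
      have := (((hasDerivAt_id t).const_mul (2 * c)).const_add (‖x‖ ^ 2)).add
        ((hasDerivAt_id t).pow 2)
      refine this.congr_deriv ?_
      simp
    have hl0 : ‖x‖ ^ 2 + 2 * c * 0 + 0 ^ 2 = ‖x‖ ^ 2 := by ring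
    have ht : Tendsto (fun t : ℝ => ‖x‖ ^ 2 + 2 * c * t + t ^ 2) (𝓝 0) (𝓝 (‖x‖ ^ 2)) := by
      have := (hl 0).continuousAt.tendsto
      rwa [hl0] at this
    have hd : deriv (fun t : ℝ => φ (‖x‖ ^ 2 + 2 * c * t + t ^ 2)) =ᶠ[𝓝 0]
        fun t => φ' (‖x‖ ^ 2 + 2 * c * t + t ^ 2) * (2 * c + 2 * t) := by
      filter_upwards [ht.eventually h₁] with t ht
      exact (ht.comp t (hl t)).deriv
    rw [hd.deriv_eq]
    have h₂' : HasDerivAt φ' d (‖x‖ ^ 2 + 2 * c * 0 + 0 ^ 2) := by rwa [hl0]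
    have h4 : HasDerivAt (fun t : ℝ => 2 * c + 2 * t) 2 0 := by
      simpa using ((hasDerivAt_id (0 : ℝ)).const_mul 2).const_add (2 * c)
    have h5 := (h₂'.comp (0 : ℝ) (hl 0)).mul h4
    refine h5.deriv.trans ?_
    simp only [Function.comp_apply, hl0]
    ring
  rw [InnerProductSpace.laplacian_eq_iteratedFDeriv_stdOrthonormalBasis]
  simp only
  rw [Finset.sum_congr rfl fun i _ => key i, Finset.sum_add_distrib, ← Finset.mul_sum]
  have hs : ∑ i, (inner ℝ x (b i)) ^ 2 = ‖x‖ ^ 2 := by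
    rw [← b.sum_sq_norm_inner_left x]
    simp
  rw [hs]
  simp
  ring

theorem laplacian_norm_sq (x : E) :
    Laplacian.laplacian (fun y : E => ‖y‖ ^ 2) x = 2 * Module.finrank ℝ E := by
  have := laplacian_comp_norm_sq (φ := fun s => s) (φ' := fun _ => 1) (d := 0) (x := x)
    contDiffAt_fun_id (Eventually.of_forall fun s => hasDerivAt_id s) (hasDerivAt_const _ _)
  simpa using this

/-- The weak minimum principle for superharmonic functions on an annulus. -/
theorem le_of_laplacian_nonpos_annulus [Nontrivial E] {f : E → ℝ} {R S c : ℝ}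
    (hf : ∀ x : E, R ≤ ‖x‖ → ContinuousAt f x)
    (hf₂ : ∀ x : E, R < ‖x‖ → ContDiffAt ℝ 2 f x)
    (hΔ : ∀ x : E, R < ‖x‖ → Laplacian.laplacian f x ≤ 0)
    (hR : ∀ x : E, ‖x‖ = R → c ≤ f x) (hS : ∀ x : E, ‖x‖ = S → c ≤ f x)
    {x : E} (hx : R ≤ ‖x‖) (hxS : ‖x‖ ≤ S) : c ≤ f x := by
  by_contra! hlt
  have hS0 : 0 ≤ S := (norm_nonneg x).trans hxS
  -- Subtracting `η ‖y‖²` makes the function strictly superharmonic, while on `‖y‖ ≤ S` it costs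
  -- less than the gap `c - f x`, so the minimum stays off both spheres.
  set η := (c - f x) / (2 * (S ^ 2 + 1)) with hη
  have hη0 : 0 < η := by apply div_pos <;> nlinarith
  have hηS : η * S ^ 2 < c - f x := by
    rw [hη, div_mul_eq_mul_div, div_lt_iff₀ (by positivity)]
    nlinarith [sub_pos.2 hlt, sq_nonneg S]
  let g : E → ℝ := fun y => f y - η * ‖y‖ ^ 2
  have hcomp : IsCompact (Metric.closedBall (0 : E) S ∩ {y | R ≤ ‖y‖}) :=
    (isCompact_closedBall 0 S).inter_right (isClosed_le continuous_const continuous_norm)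
  obtain ⟨z, ⟨hzS, hzR⟩, hz⟩ := hcomp.exists_isMinOn ⟨x, by simpa using hxS, hx⟩
    (f := g) (fun y hy => ((hf y hy.2).sub (by fun_prop)).continuousWithinAt)
  simp only [Metric.mem_closedBall, dist_zero_right, mem_ofPred_eq] at hzS hzR
  have hgx : g z ≤ g x := hz ⟨by simpa using hxS, hx⟩
  have hgz : f z < c := by
    have : η * ‖z‖ ^ 2 ≤ η * S ^ 2 := by gcongr
    have : 0 ≤ η * ‖x‖ ^ 2 := by positivity
    simp only [g] at hgx
    linarith
  have hzR' : R < ‖z‖ := lt_of_le_of_ne hzR fun h => (hR z h.symm).not_gt hgz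
  have hzS' : ‖z‖ < S := lt_of_le_of_ne hzS fun h => (hS z h).not_gt hgz
  have hmin : IsLocalMin g z := by
    have h1 : ∀ᶠ y in 𝓝 z, R < ‖y‖ := continuous_norm.continuousAt.eventually_const_lt hzR'
    have h2 : ∀ᶠ y in 𝓝 z, ‖y‖ < S := continuous_norm.continuousAt.eventually_lt_const hzS'
    filter_upwards [h1, h2] with y hy₁ hy₂
    exact hz ⟨by simpa using hy₂.le, hy₁.le⟩
  have hq : ContDiffAt ℝ 2 (fun y : E => ‖y‖ ^ 2) z := (contDiff_norm_sq ℝ).contDiffAt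
  have hq' : ContDiffAt ℝ 2 (η • fun y : E => ‖y‖ ^ 2) z := hq.const_smul η
  have hg : g = f - η • fun y : E => ‖y‖ ^ 2 := rfl
  have h0 := hmin.laplacian_nonneg (by rw [hg]; exact (hf₂ z hzR').sub hq')
  rw [hg, (hf₂ z hzR').laplacian_sub hq',
    InnerProductSpace.laplacian_smul η hq, laplacian_norm_sq] at h0
  have hfr : (0 : ℝ) < Module.finrank ℝ E := by exact_mod_cast Module.finrank_pos
  have := hΔ z hzR'
  have : 0 < η * (2 * Module.finrank ℝ E) := by positivity
  simp only [smul_eq_mul] at h0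
  linarith

/-- The weak minimum principle for superharmonic functions outside a ball. -/
theorem nonneg_of_laplacian_nonpos_exterior [Nontrivial E] {f : E → ℝ} {R : ℝ}
    (hf : ∀ x : E, R ≤ ‖x‖ → ContinuousAt f x)
    (hf₂ : ∀ x : E, R < ‖x‖ → ContDiffAt ℝ 2 f x)
    (hΔ : ∀ x : E, R < ‖x‖ → Laplacian.laplacian f x ≤ 0)
    (hR : ∀ x : E, ‖x‖ = R → 0 ≤ f x)
    (hinf : ∀ ε > 0, ∀ᶠ x in Bornology.cobounded E, -ε ≤ f x)
    {x : E} (hx : R ≤ ‖x‖) : 0 ≤ f x := by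
  refine le_of_forall_pos_le_add fun ε hε => ?_
  obtain ⟨S, -, hS⟩ := (Metric.hasBasis_cobounded_compl_closedBall (0 : E)).eventually_iff.1
    (hinf ε hε)
  have := le_of_laplacian_nonpos_annulus (S := max ‖x‖ (S + 1)) (c := -ε) hf hf₂ hΔ
    (fun y hy => by linarith [hR y hy])
    (fun y hy => hS (by
      simp only [mem_compl_iff, Metric.mem_closedBall, dist_zero_right, not_le, hy]
      exact lt_max_of_lt_right (lt_add_one S)))
    hx (le_max_left _ _)
  linarith

end Laplacian

/-! ### Radial barriers and comparison with them -/

/-- Radial comparison profiles, as functions of the squared norm. -/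
noncomputable def radialProfile (a A B C D s : ℝ) : ℝ :=
  s ^ (-a) * (A + B * Real.log s) + C * Real.log s + D

theorem contDiffAt_radialProfile (a A B C D : ℝ) {s : ℝ} (hs : 0 < s) :
    ContDiffAt ℝ 2 (radialProfile a A B C D) s := by
  have h1 : ContDiffAt ℝ 2 (fun s : ℝ => s ^ (-a)) s := Real.contDiffAt_rpow_const_of_ne hs.ne'
  have h2 : ContDiffAt ℝ 2 Real.log s := Real.contDiffAt_log.2 hs.ne'
  exact ((h1.mul (contDiffAt_const.add (contDiffAt_const.mul h2))).add
    (contDiffAt_const.mul h2)).add contDiffAt_const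

theorem tendsto_norm_sq_cobounded {E : Type*} [NormedAddCommGroup E] :
    Tendsto (fun x : E => ‖x‖ ^ 2) (Bornology.cobounded E) atTop :=
  (tendsto_pow_atTop two_ne_zero).comp tendsto_norm_cobounded_atTop

section Profile

variable {E : Type*} [NormedAddCommGroup E] [InnerProductSpace ℝ E]

theorem contDiffAt_radialProfile_norm_sq (a A B C D : ℝ) {x : E} (hx : x ≠ 0) :
    ContDiffAt ℝ 2 (fun y : E => radialProfile a A B C D (‖y‖ ^ 2)) x :=
  ContDiffAt.comp (f := fun y : E => ‖y‖ ^ 2) x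
    (contDiffAt_radialProfile a A B C D (by positivity)) (contDiff_norm_sq ℝ).contDiffAt

variable [FiniteDimensional ℝ E]

theorem laplacian_radialProfile {a : ℝ} (ha : (Module.finrank ℝ E : ℝ) = 2 * a + 2)
    (A B C D : ℝ) {x : E} (hx : x ≠ 0) :
    Laplacian.laplacian (fun y : E => radialProfile a A B C D (‖y‖ ^ 2)) x =
      -(4 * a * B) * (‖x‖ ^ 2) ^ (-a - 1) + 4 * a * C * (‖x‖ ^ 2)⁻¹ := by
  have hs : 0 < ‖x‖ ^ 2 := by positivity
  have hpow : ∀ (b : ℝ) {s : ℝ}, 0 < s → HasDerivAt (fun s : ℝ => s ^ b) (b * s ^ (b - 1)) s :=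
    fun b s hs => Real.hasDerivAt_rpow_const (Or.inl hs.ne')
  have hlog : ∀ (b c : ℝ) {s : ℝ}, 0 < s →
      HasDerivAt (fun s : ℝ => b + c * Real.log s) (c * s⁻¹) s :=
    fun b c s hs => ((Real.hasDerivAt_log hs.ne').const_mul c).const_add b
  rw [laplacian_comp_norm_sq
    (φ' := fun s => s ^ (-a - 1) * ((B - a * A) + (-(a * B)) * Real.log s) + C * s⁻¹)
    (d := (-a - 1) * (‖x‖ ^ 2) ^ (-a - 1 - 1) *
        ((B - a * A) + (-(a * B)) * Real.log (‖x‖ ^ 2)) +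
      (‖x‖ ^ 2) ^ (-a - 1) * (-(a * B) * (‖x‖ ^ 2)⁻¹) + C * (-((‖x‖ ^ 2) ^ 2)⁻¹))
    (contDiffAt_radialProfile a A B C D hs) ?_ ?_, ha]
  -- The `A` and `D` terms are harmonic; `B` produces the critical forcing `s^(-a-1) = (s^(-a))^(1 +
  -- 1/a)`, and `C` produces `1/s`, which disappears when `a = 0`.
  · generalize ‖x‖ ^ 2 = s at hs
    simp only [Real.rpow_sub_one hs.ne']
    field_simp
    ring
  · filter_upwards [eventually_gt_nhds hs] with s hs
    have := (((hpow (-a) hs).mul (hlog A B hs)).add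
      ((Real.hasDerivAt_log hs.ne').const_mul C)).add_const D
    refine this.congr_deriv ?_
    simp only [Real.rpow_sub_one hs.ne']
    field_simp
    ring
  · exact ((hpow (-a - 1) hs).mul (hlog _ _ hs)).add ((hasDerivAt_inv hs.ne').const_mul C)

/-- Comparison of a function outside a ball with a radial profile. -/
theorem radialProfile_le [Nontrivial E] {a : ℝ} (ha : (Module.finrank ℝ E : ℝ) = 2 * a + 2)
    {w : E → ℝ} {A B C D R : ℝ} (hR₀ : 0 < R)
    (hw : ∀ x : E, R ≤ ‖x‖ → ContDiffAt ℝ 2 w x)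
    (hΔ : ∀ x : E, R ≤ ‖x‖ →
      4 * a * B * (‖x‖ ^ 2) ^ (-a - 1) - 4 * a * C * (‖x‖ ^ 2)⁻¹ ≤ -Laplacian.laplacian w x)
    (hR : ∀ x : E, ‖x‖ = R → radialProfile a A B C D (R ^ 2) ≤ w x)
    (hinf : ∀ ε > 0, ∀ᶠ x in Bornology.cobounded E,
      radialProfile a A B C D (‖x‖ ^ 2) ≤ w x + ε)
    {x : E} (hx : R ≤ ‖x‖) : radialProfile a A B C D (‖x‖ ^ 2) ≤ w x := by
  have hne : ∀ y : E, R ≤ ‖y‖ → y ≠ 0 := fun y hy => norm_pos_iff.1 (hR₀.trans_le hy)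
  have hP := fun (y : E) hy => contDiffAt_radialProfile_norm_sq a A B C D (hne y hy)
  refine sub_nonneg.1 (nonneg_of_laplacian_nonpos_exterior (R := R)
    (f := w - fun y : E => radialProfile a A B C D (‖y‖ ^ 2))
    (fun y hy => ((hw y hy).sub (hP y hy)).continuousAt)
    (fun y hy => (hw y hy.le).sub (hP y hy.le)) (fun y hy => ?_) (fun y hy => ?_)
    (fun ε hε => ?_) hx)
  · rw [(hw y hy.le).laplacian_sub (hP y hy.le), laplacian_radialProfile ha _ _ _ _ (hne y hy.le)]
    linarith [hΔ y hy.le]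
  · simp only [Pi.sub_apply, hy]
    linarith [hR y hy]
  · filter_upwards [hinf ε hε] with y hy
    simp only [Pi.sub_apply]
    linarith

theorem tendsto_radialProfile_zero {a : ℝ} (ha : 0 < a) (A B : ℝ) :
    Tendsto (radialProfile a A B 0 0) atTop (𝓝 0) := by
  have h1 : Tendsto (fun s : ℝ => s ^ (-a)) atTop (𝓝 0) := tendsto_rpow_neg_atTop ha
  have h2 : Tendsto (fun s : ℝ => Real.log s / s ^ a) atTop (𝓝 0) :=
    (isLittleO_log_rpow_atTop ha).tendsto_div_nhds_zero
  have h3 := (h1.mul_const A).add (h2.const_mul B)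
  simp only [zero_mul, mul_zero, add_zero] at h3
  refine h3.congr' ?_
  filter_upwards [eventually_gt_atTop 0] with s hs
  rw [radialProfile, Real.rpow_neg hs.le]
  field_simp
  ring

/-! ### Nonexistence for differential inequalities outside a ball -/

theorem exists_pos_le_on_sphere [Nontrivial E] {w : E → ℝ} {R : ℝ} (hR : 0 < R)
    (hw : ∀ x : E, R ≤ ‖x‖ → ContDiffAt ℝ 2 w x) (hpos : ∀ x : E, R ≤ ‖x‖ → 0 < w x) :
    ∃ c > 0, ∀ x : E, ‖x‖ = R → c ≤ w x := by
  obtain ⟨z, hz⟩ := exists_norm_eq E hR.le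
  obtain ⟨y, hy, hmin⟩ := (isCompact_sphere (0 : E) R).exists_isMinOn (f := w)
    ⟨z, by simpa using hz⟩ (fun x hx => (hw x (by simp_all)).continuousAt.continuousWithinAt)
  exact ⟨w y, hpos y (by simp_all), fun x hx => hmin (by simpa using hx)⟩

/-- In dimension two, no positive superharmonic function outside a ball decays at infinity. -/
theorem false_of_superharmonic_of_finrank_eq_two [Nontrivial E] (hE : Module.finrank ℝ E = 2)
    {w : E → ℝ} {R : ℝ} (hR : 0 < R) (hw : ∀ x : E, R ≤ ‖x‖ → ContDiffAt ℝ 2 w x)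
    (hpos : ∀ x : E, R ≤ ‖x‖ → 0 < w x)
    (hΔ : ∀ x : E, R ≤ ‖x‖ → 0 ≤ -Laplacian.laplacian w x)
    (hlim : Tendsto w (Bornology.cobounded E) (𝓝 0)) : False := by
  obtain ⟨c, hc, hcR⟩ := exists_pos_le_on_sphere hR hw hpos
  have : NeBot (Bornology.cobounded E) := NormedSpace.cobounded_neBot ℝ E
  obtain ⟨x, hxc, hxR⟩ := ((hlim.eventually_lt_const (half_pos hc)).and
    (tendsto_norm_cobounded_atTop.eventually_gt_atTop R)).exists
  have hlog : 0 < Real.log (‖x‖ ^ 2) - Real.log (R ^ 2) :=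
    sub_pos.2 (Real.log_lt_log (by positivity) (by gcongr))
  -- The barrier `c - δ (log s - log R²)` equals `c` on the sphere, `c / 2 > w x` at `x`, and tends
  -- to `-∞`.
  set δ := c / 2 / (Real.log (‖x‖ ^ 2) - Real.log (R ^ 2)) with hδ
  have hδ0 : 0 < δ := by positivity
  have hδx : δ * (Real.log (‖x‖ ^ 2) - Real.log (R ^ 2)) = c / 2 := by
    rw [hδ, div_mul_cancel₀ _ hlog.ne']
  have := radialProfile_le (a := 0) (by simp [hE]) (A := 0) (B := 0) (C := -δ)
    (D := c + δ * Real.log (R ^ 2)) hR hw (fun y hy => by simpa using hΔ y hy)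
    (fun y hy => by simpa [radialProfile] using hcR y hy)
    (fun ε hε => by
      have h1 : Tendsto (fun y : E => Real.log (‖y‖ ^ 2)) (Bornology.cobounded E) atTop :=
        Real.tendsto_log_atTop.comp tendsto_norm_sq_cobounded
      filter_upwards [h1.eventually_ge_atTop ((c + δ * Real.log (R ^ 2)) / δ),
        tendsto_norm_cobounded_atTop.eventually_ge_atTop R] with y hy hyR
      rw [div_le_iff₀ hδ0] at hy
      simp only [radialProfile, zero_mul, add_zero, mul_zero]
      linarith [hpos y hyR]) hxR.le
  simp only [radialProfile, zero_mul, add_zero, mul_zero] at this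
  linarith

/-- A positive superharmonic function outside a ball is bounded below by a multiple of the
fundamental solution. -/
theorem exists_mul_rpow_le_of_superharmonic [Nontrivial E] {a : ℝ} (ha₀ : 0 < a)
    (ha : (Module.finrank ℝ E : ℝ) = 2 * a + 2)
    {w : E → ℝ} {R : ℝ} (hR : 0 < R) (hw : ∀ x : E, R ≤ ‖x‖ → ContDiffAt ℝ 2 w x)
    (hpos : ∀ x : E, R ≤ ‖x‖ → 0 < w x)
    (hΔ : ∀ x : E, R ≤ ‖x‖ → 0 ≤ -Laplacian.laplacian w x) :
    ∃ M > 0, ∀ x : E, R ≤ ‖x‖ → M * (‖x‖ ^ 2) ^ (-a) ≤ w x := by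
  obtain ⟨c, hc, hcR⟩ := exists_pos_le_on_sphere hR hw hpos
  refine ⟨c * (R ^ 2) ^ a, by positivity, fun x hx => ?_⟩
  have := radialProfile_le ha (A := c * (R ^ 2) ^ a) (B := 0) (C := 0) (D := 0) hR hw
    (fun y hy => by simpa using hΔ y hy)
    (fun y hy => by
      have h : (R ^ 2) ^ (-a) * (c * (R ^ 2) ^ a) = c := by
        rw [Real.rpow_neg (by positivity)]
        field_simp
      simpa [radialProfile, h] using hcR y hy)
    (fun ε hε => by
      filter_upwards [((tendsto_radialProfile_zero ha₀ (c * (R ^ 2) ^ a) 0).comp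
        tendsto_norm_sq_cobounded).eventually_lt_const hε,
        tendsto_norm_cobounded_atTop.eventually_ge_atTop R] with y hy hyR
      have := hpos y hyR
      simp only [Function.comp_apply] at hy
      linarith) hx
  simpa [radialProfile, mul_comm] using this

/-- No bounded positive function outside a ball satisfies `-Δ w ≥ k / |x|²`. -/
theorem false_of_inv_norm_sq_le_neg_laplacian [Nontrivial E] {a : ℝ} (ha₀ : 0 < a)
    (ha : (Module.finrank ℝ E : ℝ) = 2 * a + 2)
    {w : E → ℝ} {R k : ℝ} (hR : 0 < R) (hw : ∀ x : E, R ≤ ‖x‖ → ContDiffAt ℝ 2 w x)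
    (hpos : ∀ x : E, R ≤ ‖x‖ → 0 < w x) (hle : ∀ x : E, R ≤ ‖x‖ → w x ≤ 1)
    (hk : 0 < k) (hΔ : ∀ x : E, R ≤ ‖x‖ → k * (‖x‖ ^ 2)⁻¹ ≤ -Laplacian.laplacian w x) :
    False := by
  obtain ⟨x, hx⟩ := exists_norm_eq E (by positivity : 0 ≤ 2 * R)
  set b := k / (4 * a) with hb
  have hb0 : 0 < b := by positivity
  set θ := (‖x‖ ^ 2) ^ (-a) * (R ^ 2) ^ a with hθ
  have hθ1 : θ < 1 := by
    rw [hθ, Real.rpow_neg (by positivity), inv_mul_lt_one₀ (by rw [hx]; positivity), hx]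
    exact Real.rpow_lt_rpow (by positivity) (by nlinarith) ha₀
  -- The barrier is `D (1 - (R²/s)^a) - b (log s - log R²)`: zero on the sphere, `-∞` at infinity,
  -- and `D` makes it equal to `2` at `x`, against `w ≤ 1`.
  set D := (2 + b * (Real.log (‖x‖ ^ 2) - Real.log (R ^ 2))) / (1 - θ) with hD
  have hDx : D * (1 - θ) = 2 + b * (Real.log (‖x‖ ^ 2) - Real.log (R ^ 2)) := by
    rw [hD, div_mul_cancel₀ _ (by linarith)]
  have hDpos : 0 ≤ D := by
    have : Real.log (R ^ 2) ≤ Real.log (‖x‖ ^ 2) :=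
      Real.log_le_log (by positivity) (by rw [hx]; nlinarith)
    have : 0 ≤ b * (Real.log (‖x‖ ^ 2) - Real.log (R ^ 2)) :=
      mul_nonneg hb0.le (by linarith)
    exact div_nonneg (by linarith) (by linarith)
  have := radialProfile_le ha (A := -(D * (R ^ 2) ^ a)) (B := 0) (C := -b)
    (D := D + b * Real.log (R ^ 2)) hR hw
    (fun y hy => by
      have : 4 * a * b = k := by rw [hb]; field_simp
      have := hΔ y hy
      simp only [mul_zero, zero_mul, zero_sub, mul_neg, neg_mul, neg_neg]
      simp_all)
    (fun y hy => by
      have h : (R ^ 2) ^ (-a) * (-(D * (R ^ 2) ^ a)) = -D := by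
        rw [Real.rpow_neg (by positivity)]
        field_simp
      simp only [radialProfile, zero_mul, add_zero, h]
      linarith [hpos y hy.ge])
    (fun ε hε => by
      have h1 : Tendsto (fun y : E => Real.log (‖y‖ ^ 2)) (Bornology.cobounded E) atTop :=
        Real.tendsto_log_atTop.comp tendsto_norm_sq_cobounded
      filter_upwards [h1.eventually_ge_atTop ((D + b * Real.log (R ^ 2)) / b),
        tendsto_norm_cobounded_atTop.eventually_ge_atTop R] with y hy hyR
      rw [div_le_iff₀ hb0] at hy
      have : 0 ≤ (‖y‖ ^ 2) ^ (-a) * (D * (R ^ 2) ^ a) := by positivity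
      simp only [radialProfile, zero_mul, add_zero]
      linarith [hpos y hyR]) (x := x) (by rw [hx]; linarith)
  have h1 : (‖x‖ ^ 2) ^ (-a) * (-(D * (R ^ 2) ^ a)) = -(D * θ) := by rw [hθ]; ring
  simp only [radialProfile, zero_mul, add_zero, h1] at this
  have := hle x (by rw [hx]; linarith)
  linarith

/-- One doubling step for the lower bounds of solutions of `-Δ w ≥ w ^ (1 + 1 / a)`. -/
theorem two_mul_rpow_le_of_rpow_le_neg_laplacian [Nontrivial E] {a : ℝ} (ha₀ : 0 < a)
    (ha : (Module.finrank ℝ E : ℝ) = 2 * a + 2)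
    {w : E → ℝ} {T M : ℝ} (hM : 0 < M)
    (hw : ∀ x : E, Real.exp T ≤ ‖x‖ ^ 2 → ContDiffAt ℝ 2 w x)
    (hpos : ∀ x : E, Real.exp T ≤ ‖x‖ ^ 2 → 0 < w x)
    (hΔ : ∀ x : E, Real.exp T ≤ ‖x‖ ^ 2 → w x ^ (1 + 1 / a) ≤ -Laplacian.laplacian w x)
    (hle : ∀ x : E, Real.exp T ≤ ‖x‖ ^ 2 → M * (‖x‖ ^ 2) ^ (-a) ≤ w x)
    {x : E} (hx : Real.exp (T + 4 * a * M ^ (-(1 / a))) ≤ ‖x‖ ^ 2) :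
    2 * M * (‖x‖ ^ 2) ^ (-a) ≤ w x := by
  set R := Real.exp (T / 2) with hR
  have hR0 : 0 < R := Real.exp_pos _
  have hR2 : R ^ 2 = Real.exp T := by
    rw [hR, ← Real.exp_nat_mul]; congr 1; push_cast; ring
  have hiff : ∀ y : E, R ≤ ‖y‖ → Real.exp T ≤ ‖y‖ ^ 2 := fun y hy => by
    rw [← hR2]; gcongr
  -- With this `b`, the barrier `s^(-a) (M + b (log s - T))` satisfies `-Δ = (M s^(-a))^(1 + 1/a)`.
  -- It starts at `M s^(-a)` when `log s = T`, and the factor reaches `2M` after `log s` grows by `M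
  -- / b = 4a M^(-1/a)`.
  set b := M ^ (1 + 1 / a) / (4 * a) with hb
  have hb0 : 0 < b := by positivity
  have hxT : Real.exp T ≤ ‖x‖ ^ 2 := (Real.exp_le_exp.2 (by
    have : 0 ≤ 4 * a * M ^ (-(1 / a)) := by positivity
    linarith)).trans hx
  have hxR : R ≤ ‖x‖ := by
    rw [← hR2] at hxT
    exact le_of_sq_le_sq hxT (norm_nonneg x)
  have := radialProfile_le ha (A := M - b * T) (B := b) (C := 0) (D := 0) hR0
    (fun y hy => hw y (hiff y hy))
    (fun y hy => by
      have hs : 0 < ‖y‖ ^ 2 := (Real.exp_pos T).trans_le (hiff y hy)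
      refine le_trans (le_of_eq ?_) ((Real.rpow_le_rpow (by positivity) (hle y (hiff y hy))
        (by positivity : 0 ≤ 1 + 1 / a)).trans (hΔ y (hiff y hy)))
      rw [Real.mul_rpow hM.le (by positivity), ← Real.rpow_mul hs.le,
        show -a * (1 + 1 / a) = -a - 1 by field_simp; ring, hb]
      field_simp
      ring)
    (fun y hy => by
      have := hle y (hiff y hy.ge)
      rw [hy] at this
      have h2 : M - b * T + b * Real.log (R ^ 2) = M := by rw [hR2, Real.log_exp]; ring
      rw [radialProfile, h2]
      linarith)
    (fun ε hε => by
      filter_upwards [((tendsto_radialProfile_zero ha₀ (M - b * T) b).comp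
        tendsto_norm_sq_cobounded).eventually_lt_const hε,
        tendsto_norm_cobounded_atTop.eventually_ge_atTop R] with y hy hyR
      have := hpos y (hiff y hyR)
      simp only [Function.comp_apply] at hy
      linarith) hxR
  refine le_trans ?_ this
  have hs : 0 < ‖x‖ ^ 2 := (Real.exp_pos T).trans_le hxT
  have hlog : T + 4 * a * M ^ (-(1 / a)) ≤ Real.log (‖x‖ ^ 2) := (Real.le_log_iff_exp_le hs).2 hx
  have hbM : b * (4 * a * M ^ (-(1 / a))) = M := by
    have : M ^ (1 + 1 / a) * M ^ (-(1 / a)) = M := by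
      rw [← Real.rpow_add hM]; simp
    rw [hb, ← mul_assoc, div_mul_cancel₀ _ (by positivity), this]
  have := mul_le_mul_of_nonneg_left hlog hb0.le
  rw [radialProfile, zero_mul, add_zero, add_zero, mul_comm]
  exact mul_le_mul_of_nonneg_left (by linarith) (by positivity)

/-- There is no positive function outside a ball with `-Δ w ≥ w ^ (1 + 1 / a)`, where
`1 + 1 / a = N / (N - 2)` is the critical exponent of the exterior domain. -/
theorem false_of_rpow_le_neg_laplacian [Nontrivial E] {a : ℝ} (ha₀ : 0 < a)
    (ha : (Module.finrank ℝ E : ℝ) = 2 * a + 2)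
    {w : E → ℝ} {R : ℝ} (hR : 0 < R) (hw : ∀ x : E, R ≤ ‖x‖ → ContDiffAt ℝ 2 w x)
    (hpos : ∀ x : E, R ≤ ‖x‖ → 0 < w x)
    (hΔ : ∀ x : E, R ≤ ‖x‖ → w x ^ (1 + 1 / a) ≤ -Laplacian.laplacian w x) : False := by
  obtain ⟨M, hM, hMw⟩ := exists_mul_rpow_le_of_superharmonic ha₀ ha hR hw hpos
    (fun x hx => (Real.rpow_nonneg (hpos x hx).le _).trans (hΔ x hx))
  -- Doubling `M` multiplies the increment `4a M^(-1/a)` by `r`, so the thresholds `T k` are partial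
  -- geometric sums starting from `log R²`.
  set r : ℝ := (2 : ℝ) ^ (-(1 / a)) with hr
  have hr0 : 0 < r := by positivity
  have hr1 : r < 1 := Real.rpow_lt_one_of_one_lt_of_neg (by norm_num) (by simpa using ha₀)
  set d : ℝ := 4 * a * M ^ (-(1 / a)) with hd
  have hd0 : 0 < d := by positivity
  let T : ℕ → ℝ := fun k => 2 * Real.log R + d * ∑ i ∈ Finset.range k, r ^ i
  have hTR : ∀ k (x : E), Real.exp (T k) ≤ ‖x‖ ^ 2 → R ≤ ‖x‖ := fun k x hx => by
    refine le_of_sq_le_sq (le_trans ?_ hx) (norm_nonneg x)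
    have h1 : Real.exp (2 * Real.log R) = R ^ 2 := by
      rw [mul_comm, Real.exp_mul, Real.exp_log hR]; norm_num
    rw [← h1]
    refine Real.exp_le_exp.2 (le_add_of_nonneg_right ?_)
    positivity
  have key : ∀ k : ℕ, ∀ x : E, Real.exp (T k) ≤ ‖x‖ ^ 2 →
      2 ^ k * M * (‖x‖ ^ 2) ^ (-a) ≤ w x := by
    intro k
    induction k with
    | zero => intro x hx; simpa using hMw x (hTR 0 x hx)
    | succ k ih =>
      intro x hx
      have := two_mul_rpow_le_of_rpow_le_neg_laplacian ha₀ ha (T := T k) (M := 2 ^ k * M)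
        (by positivity) (fun y hy => hw y (hTR k y hy)) (fun y hy => hpos y (hTR k y hy))
        (fun y hy => hΔ y (hTR k y hy)) ih (x := x) (by
          refine le_trans (le_of_eq ?_) hx
          congr 1
          simp only [T, Finset.sum_range_succ]
          rw [Real.mul_rpow (by positivity) hM.le, ← Real.rpow_natCast 2 k,
            ← Real.rpow_mul (by norm_num), mul_comm (k : ℝ), Real.rpow_mul (by norm_num),
            Real.rpow_natCast, hd]
          ring)
      rw [pow_succ]
      linarith
  -- This point lies beyond the limit of all thresholds, so every doubled bound holds at it.
  obtain ⟨x, hx⟩ := exists_norm_eq E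
    (Real.exp_pos ((2 * Real.log R + d * (1 - r)⁻¹) / 2)).le
  have hxT : ∀ k, Real.exp (T k) ≤ ‖x‖ ^ 2 := fun k => by
    rw [hx, ← Real.exp_nat_mul]
    refine Real.exp_le_exp.2 ?_
    have := (summable_geometric_of_lt_one hr0.le hr1).sum_le_tsum (Finset.range k)
      (fun i _ => by positivity)
    rw [tsum_geometric_of_lt_one hr0.le hr1] at this
    have := mul_le_mul_of_nonneg_left this hd0.le
    push_cast
    simp only [T]
    linarith
  have hs : 0 < ‖x‖ ^ 2 := (Real.exp_pos (T 0)).trans_le (hxT 0)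
  have hc : 0 < M * (‖x‖ ^ 2) ^ (-a) := by positivity
  obtain ⟨k, hk⟩ := pow_unbounded_of_one_lt (w x / (M * (‖x‖ ^ 2) ^ (-a))) one_lt_two
  rw [div_lt_iff₀ hc] at hk
  have := key k x (hxT k)
  linarith

end Profile

/-! ### Application to the system -/

theorem IsContDiffUpToBoundary.contDiffAt {E : Type*} [NormedAddCommGroup E] [NormedSpace ℝ E]
    {n : ℕ} {u : E → ℝ} {Ω : Set E} (h : IsContDiffUpToBoundary n u Ω) (hΩ : IsOpen Ω) {x : E}
    (hx : x ∈ Ω) : ContDiffAt ℝ n u x :=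
  h.contDiffOn.contDiffAt (hΩ.mem_nhds hx)

theorem theorem2p1 (N : ℕ) (hN : 2 ≤ N)
    (K : Set (EuclideanSpace ℝ (Fin N))) (hK : IsAdmissibleObstacle K)
    (p q m s lam : ℝ) (hp : 0 < p) (hq : 0 < q) (hm : 0 < m) (hs : 0 < s) (hlam : 0 < lam)
    (γ : ℝ≥0) (hγ : 0 < γ) (hγ' : γ < 1)
    (ρ : EuclideanSpace ℝ (Fin N) → ℝ) (hρ : IsLocallyHolderOn γ ρ (closure Kᶜ))
    (hρ_nonneg : ∀ x ∈ closure Kᶜ, 0 ≤ ρ x)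
    (hcase : N = 2 ∨
      (3 ≤ N ∧ m ≤ 2 / ((N : ℝ) - 2)) ∨
      (3 ≤ N ∧ p ≤ (N : ℝ) / ((N : ℝ) - 2))) :
    ¬ ∃ u v : EuclideanSpace ℝ (Fin N) → ℝ, IsPositiveGMSolution K p q m s lam ρ u v := by
  rintro ⟨u, v, h⟩
  have : Nonempty (Fin N) := ⟨⟨0, by omega⟩⟩
  have hKo : IsOpen Kᶜ := hK.isCompact.isClosed.isOpen_compl
  obtain ⟨S, -, hS⟩ := (Metric.hasBasis_cobounded_compl_closedBall
    (0 : EuclideanSpace ℝ (Fin N))).eventually_iff.1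
    ((Filter.eventually_mem_set.2 (Bornology.isBounded_def.1 hK.isCompact.isBounded)).and
      ((h.u_decay.eventually_lt_const one_pos).and (h.v_decay.eventually_lt_const one_pos)))
  -- `S + 1` leaves the closed ball strictly; `1 ≤ R` lets powers of `‖x‖²` be compared by their
  -- exponents.
  set R := max 1 (S + 1) with hR
  have hR1 : 1 ≤ R := le_max_left _ _
  have hR0 : 0 < R := one_pos.trans_le hR1
  have hfar : ∀ x : EuclideanSpace ℝ (Fin N), R ≤ ‖x‖ → x ∈ Kᶜ ∧ u x < 1 ∧ v x < 1 := by
    refine fun x hx => hS ?_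
    simp only [mem_compl_iff, Metric.mem_closedBall, dist_zero_right, not_le]
    exact (lt_add_one S).trans_le ((le_max_right _ _).trans hx)
  have hu := fun (x : EuclideanSpace ℝ (Fin N)) (hx : R ≤ ‖x‖) =>
    h.u_regular.contDiffAt hKo (hfar x hx).1
  have hv := fun (x : EuclideanSpace ℝ (Fin N)) (hx : R ≤ ‖x‖) =>
    h.v_regular.contDiffAt hKo (hfar x hx).1
  have hu0 := fun (x : EuclideanSpace ℝ (Fin N)) (hx : R ≤ ‖x‖) => h.u_pos x (hfar x hx).1
  have hv0 := fun (x : EuclideanSpace ℝ (Fin N)) (hx : R ≤ ‖x‖) => h.v_pos x (hfar x hx).1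
  have hΔu : ∀ x : EuclideanSpace ℝ (Fin N), R ≤ ‖x‖ →
      u x ^ p ≤ -Laplacian.laplacian u x := fun x hx => by
    rw [h.u_eq x (hfar x hx).1]
    have h1 : u x ^ p ≤ u x ^ p / v x ^ q :=
      le_div_self (Real.rpow_nonneg (hu0 x hx).le _) (Real.rpow_pos_of_pos (hv0 x hx) _)
        (Real.rpow_le_one (hv0 x hx).le (hfar x hx).2.2.le hq.le)
    have := mul_nonneg hlam.le (hρ_nonneg x (subset_closure (hfar x hx).1))
    linarith
  have hΔv : ∀ x : EuclideanSpace ℝ (Fin N), R ≤ ‖x‖ →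
      u x ^ m ≤ -Laplacian.laplacian v x := fun x hx => by
    rw [h.v_eq x (hfar x hx).1]
    exact le_div_self (Real.rpow_nonneg (hu0 x hx).le _) (Real.rpow_pos_of_pos (hv0 x hx) _)
      (Real.rpow_le_one (hv0 x hx).le (hfar x hx).2.2.le hs.le)
  have hΔu0 : ∀ x : EuclideanSpace ℝ (Fin N), R ≤ ‖x‖ → 0 ≤ -Laplacian.laplacian u x :=
    fun x hx => (Real.rpow_nonneg (hu0 x hx).le _).trans (hΔu x hx)
  rcases hcase with rfl | hcase
  · exact false_of_superharmonic_of_finrank_eq_two (by simp) hR0 hu hu0 hΔu0 h.u_decay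
  have hN3 : 3 ≤ N := hcase.elim And.left And.left
  have hN3' : (3 : ℝ) ≤ N := by exact_mod_cast hN3
  obtain ⟨a, ha⟩ : ∃ a : ℝ, a = ((N : ℝ) - 2) / 2 := ⟨_, rfl⟩
  have ha0 : 0 < a := by rw [ha]; linarith
  have hNa : (N : ℝ) - 2 = 2 * a := by rw [ha]; ring
  have hdim : (Module.finrank ℝ (EuclideanSpace ℝ (Fin N)) : ℝ) = 2 * a + 2 := by
    rw [finrank_euclideanSpace_fin]; linarith
  rcases hcase with ⟨-, hcase⟩ | ⟨-, hcase⟩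
  · obtain ⟨M, hM, hMu⟩ := exists_mul_rpow_le_of_superharmonic ha0 hdim hR0 hu hu0 hΔu0
    refine false_of_inv_norm_sq_le_neg_laplacian (k := M ^ m) ha0 hdim hR0 hv hv0
      (fun x hx => (hfar x hx).2.2.le) (by positivity) fun x hx => ?_
    refine le_trans ?_ (hΔv x hx)
    have hx1 : 1 ≤ ‖x‖ ^ 2 := one_le_pow₀ (hR1.trans hx)
    refine le_trans ?_ (Real.rpow_le_rpow (by positivity) (hMu x hx) hm.le)
    rw [Real.mul_rpow hM.le (by positivity), ← Real.rpow_mul (by positivity),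
      ← Real.rpow_neg_one (‖x‖ ^ 2)]
    refine mul_le_mul_of_nonneg_left (Real.rpow_le_rpow_of_exponent_le hx1 ?_) (by positivity)
    rw [hNa, le_div_iff₀ (by positivity)] at hcase
    linarith
  · refine false_of_rpow_le_neg_laplacian ha0 hdim hR0 hu hu0 fun x hx => ?_
    refine (Real.rpow_le_rpow_of_exponent_ge (hu0 x hx) (hfar x hx).2.1.le ?_).trans (hΔu x hx)
    refine hcase.trans (le_of_eq ?_)
    rw [hNa, show (N : ℝ) = 2 * a + 2 by linarith]
    field_simp
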